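/- Let $\alpha_1\ge\alpha_2>0$ and $m_1,m_2,\nu>0$, put $|m|=m_1+m_2$, and let $\chi^2_{m_1},\chi^2_{m_2},V$ be independent random variables having chi-square distributions with $m_1$, $m_2$ and $\nu$ degrees of freedom respectively. Put $$W=\frac{(\alpha_1\chi^2_{m_1}+\alpha_2\chi^2_{m_2})/|m|}{V/\nu},\qquad a=\frac{\nu\alpha_2}{|m|},\qquad A=\left(\frac{\alpha_1}{\alpha_2}\right)^{-m_1/2},$$ $$B_0=a^{\nu/2}\,\frac{\Gamma\left(\frac{\nu+|m|}{2}\right)}{\Gamma\left(\frac{|m|}{2}\right)\Gamma\left(\frac{\nu}{2}\right)},\qquad B_1(w)=\frac{w^{(|m|-2)/2}}{(a+w)^{(\nu+|m|)/2}}\quad(w>0).$$ Then $W$ has a probability density $h_W$ with respect to Lebesgue measure, given by $h_W(w)=0$ for $w\le 0$ and, for $w>0$, $$h_W(w)=A\,B_0\,B_1(w)\sum_{j=0}^{\infty}\frac{\left(\frac{\nu+m_1+m_2}{2}\right)_j\left(\frac{m_1}{2}\right)_j}{j!\,\left(\frac{m_1+m_2}{2}\right)_j}\left(\Big(1-\frac{\alpha_2}{\alpha_1}\Big)\frac{w}{a+w}\right)^j$$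 $$=A\,B_0\,B_1(w)\;{}_2F_1\!\left(\frac{\nu+m_1+m_2}{2},\frac{m_1}{2};\frac{m_1+m_2}{2};\Big(1-\frac{\alpha_2}{\alpha_1}\Big)\frac{w}{a+w}\right),$$ where $(x)_j=x(x+1)\cdots(x+j-1)$ and the series converges. -/

import Mathlib

open MeasureTheory ProbabilityTheory

noncomputable section

namespace GeneralizedF

/-- The chi-square distribution with `k > 0` degrees of freedom (not necessarily an integer):
density `x ^ (k/2 - 1) * exp (-x/2) / (2 ^ (k/2) * Γ (k/2))` on `x ≥ 0`, that is, the gamma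
distribution of shape `k/2` and rate `1/2`. -/
def chiSquare (k : ℝ) : Measure ℝ := gammaMeasure (k / 2) (1 / 2)

/-- `A = ∏ (α_i / α_r) ^ (-m_i / 2)` for `r = 2`. -/
def constA (α₁ α₂ m₁ m₂ : ℝ) : ℝ :=
  (α₁ / α₂) ^ (-(m₁ / 2)) * (α₂ / α₂) ^ (-(m₂ / 2))

/-- The scale `a = ν α₂ / |m|`, with `|m| = m₁ + m₂`. -/
def scale (α₂ m₁ m₂ ν : ℝ) : ℝ := ν * α₂ / (m₁ + m₂)

/-- `B₀ = a ^ (ν/2) Γ((ν + |m|)/2) / (Γ(|m|/2) Γ(ν/2))`. -/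
def constB₀ (α₂ m₁ m₂ ν : ℝ) : ℝ :=
  scale α₂ m₁ m₂ ν ^ (ν / 2) *
    (Real.Gamma ((ν + (m₁ + m₂)) / 2) / (Real.Gamma ((m₁ + m₂) / 2) * Real.Gamma (ν / 2)))

/-- `B₁(w) = w ^ ((|m| - 2)/2) / (a + w) ^ ((ν + |m|)/2)`. -/
def funB₁ (α₂ m₁ m₂ ν w : ℝ) : ℝ :=
  w ^ ((m₁ + m₂ - 2) / 2) / (scale α₂ m₁ m₂ ν + w) ^ ((ν + (m₁ + m₂)) / 2)

/-- The function `h_W`; it is supported on the positive half-line. -/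
def density (α₁ α₂ m₁ m₂ ν w : ℝ) : ℝ :=
  if 0 < w then
    constA α₁ α₂ m₁ m₂ * constB₀ α₂ m₁ m₂ ν * funB₁ α₂ m₁ m₂ ν w *
      ordinaryHypergeometric ((ν + m₁ + m₂) / 2) (m₁ / 2) ((m₁ + m₂) / 2)
        ((1 - α₂ / α₁) * (w / (scale α₂ m₁ m₂ ν + w)))
  else 0

/-- The `j`-th term of the hypergeometric series in the variable `z`, with the parameters
`a = (ν + m₁ + m₂)/2`, `b = m₁/2`, `c = (m₁ + m₂)/2`:  `(a)_j (b)_j / (j! (c)_j) z ^ j`. -/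
def seriesTerm (m₁ m₂ ν z : ℝ) (j : ℕ) : ℝ :=
  (ascPochhammer ℝ j).eval ((ν + m₁ + m₂) / 2) * (ascPochhammer ℝ j).eval (m₁ / 2) /
    ((j.factorial : ℝ) * (ascPochhammer ℝ j).eval ((m₁ + m₂) / 2)) * z ^ j

end GeneralizedF

end

namespace GeneralizedF

open scoped ENNReal

/-! A gamma law of rate `s` is a negative binomial mixture of gamma laws of any larger rate `r`,
with shapes raised by `j`: expand `exp((r - s)x)` in `exp(-sx) = exp(-rx) exp((r - s)x)`
(`lintegral_gammaMeasure_eq_tsum`). Write `W` as a sum of two scaled gamma variables over `V`, and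
give the first summand the rate of the second this way. In each component the summands add up to a
single gamma variable (`lintegral_lintegral_add_gammaMeasure`), whose ratio to `V` is beta prime
(`lintegral_lintegral_div_gammaMeasure`). Weight times beta prime density is exactly the `j`-th term
of the hypergeometric series. Laws are handled as integrals of arbitrary measurable `f ≥ 0`, so
Tonelli applies without integrability conditions. -/

lemma lintegral_eq_mul_lintegral_comp_mul_left (f : ℝ → ℝ≥0∞) {c : ℝ} (hc : 0 < c) :
    ∫⁻ x, f x = ENNReal.ofReal c * ∫⁻ x, f (c * x) := by
  have h := Real.smul_map_volume_mul_left hc.ne'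
  rw [abs_of_pos hc] at h
  have e : MeasurableEmbedding (fun x : ℝ => c * x) :=
    (Homeomorph.mulLeft₀ c hc.ne').measurableEmbedding
  conv_lhs => rw [← h]
  rw [lintegral_smul_measure, e.lintegral_map, smul_eq_mul]

lemma lintegral_eq_mul_lintegral_comp_mul_right (f : ℝ → ℝ≥0∞) {c : ℝ} (hc : 0 < c) :
    ∫⁻ x, f x = ENNReal.ofReal c * ∫⁻ x, f (x * c) := by
  simp_rw [mul_comm _ c]
  exact lintegral_eq_mul_lintegral_comp_mul_left f hc

@[fun_prop]
lemma measurable_gammaPDF (a r : ℝ) : Measurable (gammaPDF a r) :=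
  (measurable_gammaPDFReal a r).ennreal_ofReal

lemma lintegral_gammaMeasure (a r : ℝ) {f : ℝ → ℝ≥0∞} (hf : Measurable f) :
    ∫⁻ x, f x ∂gammaMeasure a r = ∫⁻ x, gammaPDF a r x * f x := by
  rw [gammaMeasure, lintegral_withDensity_eq_lintegral_mul _ (by fun_prop) hf]
  rfl

lemma ofReal_mul_gammaPDF_mul {a r c : ℝ} (hc : 0 < c) (hr : 0 < r) (x : ℝ) :
    ENNReal.ofReal c * gammaPDF a r (c * x) = gammaPDF a (c * r) x := by
  rcases lt_or_ge x 0 with hx | hx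
  · rw [gammaPDF_of_neg hx, gammaPDF_of_neg (mul_neg_of_pos_of_neg hc hx), mul_zero]
  · rw [gammaPDF_of_nonneg hx, gammaPDF_of_nonneg (by positivity), ← ENNReal.ofReal_mul hc.le,
      Real.mul_rpow hc.le hx, Real.mul_rpow hc.le hr.le, Real.rpow_sub_one hc.ne']
    congr 1
    rw [show c * r * x = r * (c * x) by ring]
    field_simp

lemma lintegral_comp_mul_gammaMeasure {a r c : ℝ} (hc : 0 < c) (hr : 0 < r)
    {f : ℝ → ℝ≥0∞} (hf : Measurable f) :
    ∫⁻ x, f (c * x) ∂gammaMeasure a (c * r) = ∫⁻ x, f x ∂gammaMeasure a r := by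
  rw [lintegral_gammaMeasure _ _ hf, lintegral_gammaMeasure _ _ (by fun_prop),
    lintegral_eq_mul_lintegral_comp_mul_left (fun x => gammaPDF a r x * f x) hc,
    ← lintegral_const_mul _ (by fun_prop)]
  simp_rw [← ofReal_mul_gammaPDF_mul hc hr, mul_assoc]

/-! ### Gamma laws as mixtures of gamma laws of larger rate -/

lemma Gamma_add_natCast {a : ℝ} (ha : 0 < a) (j : ℕ) :
    Real.Gamma (a + j) = (ascPochhammer ℝ j).eval a * Real.Gamma a := by
  induction j with
  | zero => simp
  | succ j ih =>
    have : a + j ≠ 0 := by positivity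
    rw [Nat.cast_succ, ← add_assoc, Real.Gamma_add_one this, ih, ascPochhammer_succ_eval]
    ring

/-- The negative binomial weights expressing a gamma law of rate `s` as a mixture of gamma laws
of rate `r`, where `q = s / r`. -/
noncomputable def mixtureWeight (a q : ℝ) (j : ℕ) : ℝ :=
  q ^ a * ((ascPochhammer ℝ j).eval a / j.factorial) * (1 - q) ^ j

lemma mixtureWeight_nonneg {a q : ℝ} (ha : 0 < a) (hq : 0 ≤ q) (hq1 : q ≤ 1) (j : ℕ) :
    0 ≤ mixtureWeight a q j := by
  have := (ascPochhammer_pos j a ha).le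
  have : 0 ≤ 1 - q := by linarith
  unfold mixtureWeight
  positivity

lemma hasSum_mixtureWeight_mul_gammaPDFReal {a s r x : ℝ} (ha : 0 < a) (hs : 0 < s) (hr : 0 < r)
    (hx : 0 < x) :
    HasSum (fun j : ℕ => mixtureWeight a (s / r) j * gammaPDFReal (a + j) r x)
      (gammaPDFReal a s x) := by
  have h := (NormedSpace.expSeries_div_hasSum_exp ((r - s) * x)).mul_left
    (s ^ a / Real.Gamma a * x ^ (a - 1) * Real.exp (-(r * x)))
  rw [← Real.exp_eq_exp_ℝ, mul_assoc _ (Real.exp _), ← Real.exp_add,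
    show -(r * x) + (r - s) * x = -(s * x) by ring] at h
  convert! h using 1
  · ext j
    have hP := (ascPochhammer_pos j a ha).ne'
    have hG := (Real.Gamma_pos_of_pos ha).ne'
    have hra := (Real.rpow_pos_of_pos hr a).ne'
    rw [gammaPDFReal, if_pos hx.le, mixtureWeight, Gamma_add_natCast ha,
      Real.rpow_add hr, Real.rpow_natCast, show a + j - 1 = (a - 1) + j by ring,
      Real.rpow_add hx, Real.rpow_natCast, Real.div_rpow hs.le hr.le, mul_pow,
      show (r - s) = (1 - s / r) * r by field_simp, mul_pow]
    field_simp
  · rw [gammaPDFReal, if_pos hx.le]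

/-- The condition `s ≤ r` makes the weights nonnegative, which the passage to `ℝ≥0∞` needs. -/
lemma gammaPDF_eq_tsum {a s r x : ℝ} (ha : 0 < a) (hs : 0 < s) (hsr : s ≤ r) (hx : x ≠ 0) :
    gammaPDF a s x =
      ∑' j : ℕ, ENNReal.ofReal (mixtureWeight a (s / r) j) * gammaPDF (a + j) r x := by
  have hr : 0 < r := hs.trans_le hsr
  rcases hx.lt_or_gt with hx | hx
  · simp [gammaPDF_of_neg hx]
  · have hw := mixtureWeight_nonneg ha (div_pos hs hr).le ((div_le_one hr).2 hsr)
    have h := hasSum_mixtureWeight_mul_gammaPDFReal ha hs hr hx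
    rw [gammaPDF, ← h.tsum_eq, ENNReal.ofReal_tsum_of_nonneg _ h.summable]
    · simp_rw [ENNReal.ofReal_mul (hw _), gammaPDF]
    · exact fun j => mul_nonneg (hw j) (gammaPDFReal_nonneg (by positivity) hr x)

lemma lintegral_gammaMeasure_eq_tsum {a s r : ℝ} (ha : 0 < a) (hs : 0 < s) (hsr : s ≤ r)
    {f : ℝ → ℝ≥0∞} (hf : Measurable f) :
    ∫⁻ x, f x ∂gammaMeasure a s =
      ∑' j : ℕ, ENNReal.ofReal (mixtureWeight a (s / r) j) *
        ∫⁻ x, f x ∂gammaMeasure (a + j) r := by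
  have hm (j : ℕ) : Measurable (fun x => gammaPDF (a + j) r x * f x) := by fun_prop
  simp_rw [lintegral_gammaMeasure _ _ hf, ← lintegral_const_mul _ (hm _)]
  rw [← lintegral_tsum (fun _ => by fun_prop)]
  refine lintegral_congr_ae ?_
  filter_upwards [Measure.ae_ne volume (0 : ℝ)] with x hx
  simp_rw [gammaPDF_eq_tsum ha hs hsr hx, ← ENNReal.tsum_mul_right, mul_assoc]

/-! ### Sums of independent gamma variables -/

/-- Total and proportion separate: the exponentials combine to `exp(-rs)`, and the powers split into
one of `s` and a beta kernel in `u`. The factor `s` is the Jacobian of `x = su`. The endpoints are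
excluded because a gamma density of shape 1 is nonzero at 0, where the beta density vanishes. -/
lemma ofReal_mul_gammaPDF_mul_gammaPDF {a b r s u : ℝ} (ha : 0 < a) (hb : 0 < b) (hr : 0 < r)
    (hs : 0 < s) (hu₀ : u ≠ 0) (hu₁ : u ≠ 1) :
    ENNReal.ofReal s * (gammaPDF a r (s * u) * gammaPDF b r (s - s * u)) =
      gammaPDF (a + b) r s * betaPDF a b u := by
  rcases hu₀.lt_or_gt with h0 | h0
  · rw [gammaPDF_of_neg (mul_neg_of_pos_of_neg hs h0), betaPDF_eq_zero_of_nonpos h0.le]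
    simp
  rcases hu₁.lt_or_gt with h1 | h1
  · have h1' : 0 < 1 - u := by linarith
    have hab := (Real.Gamma_pos_of_pos (add_pos ha hb))
    have hA := Real.Gamma_pos_of_pos ha
    have hB := Real.Gamma_pos_of_pos hb
    rw [show s - s * u = s * (1 - u) by ring, gammaPDF_of_nonneg (by positivity),
      gammaPDF_of_nonneg (by positivity), gammaPDF_of_nonneg hs.le, betaPDF_of_pos_lt_one h0 h1,
      ← ENNReal.ofReal_mul (by positivity), ← ENNReal.ofReal_mul (by positivity),
      ← ENNReal.ofReal_mul (by positivity)]
    congr 1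
    rw [Real.mul_rpow hs.le h0.le, Real.mul_rpow hs.le h1'.le, beta, Real.rpow_add hr,
      show a + b - 1 = (a - 1) + (b - 1) + 1 by ring, Real.rpow_add hs, Real.rpow_add hs,
      Real.rpow_one, show -(r * s) = -(r * (s * u)) + -(r * (s * (1 - u))) by ring, Real.exp_add]
    field_simp
  · rw [gammaPDF_of_neg (x := s - s * u) (by nlinarith), betaPDF_eq_zero_of_one_le h1.le]
    simp

lemma lintegral_gammaPDF_mul_gammaPDF_sub {a b r s : ℝ} (ha : 0 < a) (hb : 0 < b) (hr : 0 < r)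
    (hs : s ≠ 0) :
    ∫⁻ x, gammaPDF a r x * gammaPDF b r (s - x) = gammaPDF (a + b) r s := by
  rcases hs.lt_or_gt with hs | hs
  · rw [gammaPDF_of_neg hs, lintegral_eq_zero_iff (by fun_prop)]
    refine ae_of_all _ fun x => ?_
    rcases lt_or_ge x 0 with hx | hx
    · simp [gammaPDF_of_neg hx]
    · simp [gammaPDF_of_neg (show s - x < 0 by linarith)]
  · have hm : Measurable (betaPDF a b) := (measurable_betaPDFReal a b).ennreal_ofReal
    -- After `x = su`, the right side is multiplied by the total mass 1 of the beta law, so that the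
    -- integrands can be compared pointwise.
    rw [lintegral_eq_mul_lintegral_comp_mul_left _ hs, ← lintegral_const_mul _ (by fun_prop),
      ← mul_one (gammaPDF (a + b) r s), ← lintegral_betaPDF_eq_one ha hb,
      ← lintegral_const_mul _ hm]
    refine lintegral_congr_ae ?_
    filter_upwards [Measure.ae_ne volume (0 : ℝ), Measure.ae_ne volume (1 : ℝ)] with u h0 h1
    exact ofReal_mul_gammaPDF_mul_gammaPDF ha hb hr hs h0 h1

lemma lintegral_lintegral_add_gammaMeasure {a b r : ℝ} (ha : 0 < a) (hb : 0 < b) (hr : 0 < r)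
    {f : ℝ → ℝ≥0∞} (hf : Measurable f) :
    ∫⁻ x, ∫⁻ y, f (x + y) ∂gammaMeasure b r ∂gammaMeasure a r =
      ∫⁻ s, f s ∂gammaMeasure (a + b) r := by
  have h1 (x : ℝ) : ∫⁻ y, f (x + y) ∂gammaMeasure b r = ∫⁻ s, gammaPDF b r (s - x) * f s := by
    rw [lintegral_gammaMeasure _ _ (by fun_prop),
      ← lintegral_sub_right_eq_self _ x]
    simp
  have hm : Measurable (fun x => ∫⁻ s, gammaPDF b r (s - x) * f s) :=
    Measurable.lintegral_prod_right' (f := fun p : ℝ × ℝ => gammaPDF b r (p.2 - p.1) * f p.2)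
      (by fun_prop)
  simp_rw [h1]
  rw [lintegral_gammaMeasure _ _ hm, lintegral_gammaMeasure _ _ hf]
  have hm' (x : ℝ) : Measurable (fun s => gammaPDF b r (s - x) * f s) := by fun_prop
  simp_rw [← lintegral_const_mul _ (hm' _)]
  rw [lintegral_lintegral_swap (by fun_prop)]
  refine lintegral_congr_ae ?_
  filter_upwards [Measure.ae_ne volume (0 : ℝ)] with s hs
  simp_rw [← mul_assoc]
  rw [lintegral_mul_const _ (by fun_prop), lintegral_gammaPDF_mul_gammaPDF_sub ha hb hr hs]

/-! ### Ratios of independent gamma variables -/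

/-- The density of the ratio of independent gamma variables of shapes `b`, `n` and rates
`s / c`, `s`: the beta prime density of scale `c`. -/
noncomputable def betaPrimePDFReal (b n c w : ℝ) : ℝ :=
  if 0 < w then
    Real.Gamma (b + n) / (Real.Gamma b * Real.Gamma n) * c ^ n * (w ^ (b - 1) / (c + w) ^ (b + n))
  else 0

lemma betaPrimePDFReal_nonneg {b n c : ℝ} (hb : 0 < b) (hn : 0 < n) (hc : 0 < c) (w : ℝ) :
    0 ≤ betaPrimePDFReal b n c w := by
  unfold betaPrimePDFReal
  split_ifs
  · positivity
  · exact le_rfl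

@[fun_prop]
lemma measurable_betaPrimePDFReal (b n c : ℝ) : Measurable (betaPrimePDFReal b n c) :=
  Measurable.ite measurableSet_Ioi (by fun_prop) measurable_const

/-- As a function of `v` the left side is a gamma kernel of shape `b + n` and rate `s + sw/c`; the
constant left after normalising it is the beta prime density at `w`. The factor `v` is the Jacobian
of `t = wv`. -/
lemma ofReal_mul_gammaPDF_mul_gammaPDF_mul {b n c s w v : ℝ} (hb : 0 < b) (hn : 0 < n)
    (hc : 0 < c) (hs : 0 < s) (hw : 0 < w) (hv : 0 < v) :
    ENNReal.ofReal v * (gammaPDF n s v * gammaPDF b (s / c) (w * v)) =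
      ENNReal.ofReal (betaPrimePDFReal b n c w) * gammaPDF (b + n) (s * (c + w) / c) v := by
  have hbn := (Real.Gamma_pos_of_pos (add_pos hb hn))
  have hB := Real.Gamma_pos_of_pos hb
  have hN := Real.Gamma_pos_of_pos hn
  rw [gammaPDF_of_nonneg (by positivity), gammaPDF_of_nonneg (by positivity),
    gammaPDF_of_nonneg hv.le, ← ENNReal.ofReal_mul (by positivity),
    ← ENNReal.ofReal_mul (by positivity),
    ← ENNReal.ofReal_mul (betaPrimePDFReal_nonneg hb hn hc w), betaPrimePDFReal, if_pos hw]
  congr 1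
  rw [Real.mul_rpow hw.le hv.le, Real.div_rpow (by positivity) hc.le,
    Real.div_rpow (by positivity) hc.le, Real.mul_rpow hs.le (by positivity),
    Real.rpow_add hs, Real.rpow_add hc,
    show b + n - 1 = (b - 1) + (n - 1) + 1 by ring, Real.rpow_add hv, Real.rpow_add hv,
    Real.rpow_one, show -(s * (c + w) / c * v) = -(s * v) + -(s / c * (w * v)) by
      field_simp; ring, Real.exp_add]
  field_simp

lemma lintegral_lintegral_div_gammaMeasure {b n c s : ℝ} (hb : 0 < b) (hn : 0 < n)
    (hc : 0 < c) (hs : 0 < s) {f : ℝ → ℝ≥0∞} (hf : Measurable f) :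
    ∫⁻ t, ∫⁻ v, f (t / v) ∂gammaMeasure n s ∂gammaMeasure b (s / c) =
      ∫⁻ w, ENNReal.ofReal (betaPrimePDFReal b n c w) * f w := by
  have hm (t : ℝ) : Measurable (fun v => f (t / v)) := by fun_prop
  have hm' : Measurable (fun t => ∫⁻ v, gammaPDF n s v * f (t / v)) :=
    Measurable.lintegral_prod_right' (f := fun p : ℝ × ℝ => gammaPDF n s p.2 * f (p.1 / p.2))
      (by fun_prop)
  simp_rw [lintegral_gammaMeasure _ _ (hm _)]
  rw [lintegral_gammaMeasure _ _ hm']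
  have hm'' (t : ℝ) : Measurable (fun v => gammaPDF n s v * f (t / v)) := by fun_prop
  simp_rw [← lintegral_const_mul _ (hm'' _)]
  -- With `v` outermost, `t = wv` can be substituted for each fixed `v`; a second swap then
  -- integrates `v` out.
  rw [lintegral_lintegral_swap (by fun_prop)]
  have key : ∀ᵐ v : ℝ, ∫⁻ t, gammaPDF b (s / c) t * (gammaPDF n s v * f (t / v)) =
      ∫⁻ w, ENNReal.ofReal v * (gammaPDF n s v * gammaPDF b (s / c) (w * v)) * f w := by
    filter_upwards [Measure.ae_ne volume (0 : ℝ)] with v hv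
    rcases hv.lt_or_gt with hv | hv
    · simp [gammaPDF_of_neg hv]
    · rw [lintegral_eq_mul_lintegral_comp_mul_right _ hv, ← lintegral_const_mul _ (by fun_prop)]
      refine lintegral_congr fun w => ?_
      rw [mul_div_cancel_right₀ _ hv.ne']
      ring
  rw [lintegral_congr_ae key, lintegral_lintegral_swap (by fun_prop)]
  refine lintegral_congr_ae ?_
  filter_upwards [Measure.ae_ne volume (0 : ℝ)] with w hw
  rw [lintegral_mul_const _ (by fun_prop)]
  congr 1
  rcases hw.lt_or_gt with hw | hw
  · rw [betaPrimePDFReal, if_neg hw.not_gt, ENNReal.ofReal_zero, lintegral_eq_zero_iff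
      (by fun_prop)]
    filter_upwards [Measure.ae_ne volume (0 : ℝ)] with v hv
    rcases hv.lt_or_gt with hv | hv
    · simp [gammaPDF_of_neg hv]
    · simp [gammaPDF_of_neg (mul_neg_of_neg_of_pos hw hv)]
  · rw [← mul_one (ENNReal.ofReal (betaPrimePDFReal _ _ _ _)),
      ← lintegral_gammaPDF_eq_one (add_pos hb hn) (show 0 < s * (c + w) / c by positivity),
      ← lintegral_const_mul _ (by fun_prop)]
    refine lintegral_congr_ae ?_
    filter_upwards [Measure.ae_ne volume (0 : ℝ)] with v hv
    rcases hv.lt_or_gt with hv | hv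
    · simp [gammaPDF_of_neg hv]
    · exact ofReal_mul_gammaPDF_mul_gammaPDF_mul hb hn hc hs hw hv

/-! ### The hypergeometric series and its beta prime terms -/

lemma hasSum_ordinaryHypergeometric {a b c x : ℝ} (ha : 0 < a) (hb : 0 < b) (hc : 0 < c)
    (hx : |x| < 1) :
    HasSum (fun j : ℕ => (ascPochhammer ℝ j).eval a * (ascPochhammer ℝ j).eval b /
      ((j.factorial : ℝ) * (ascPochhammer ℝ j).eval c) * x ^ j)
      (ordinaryHypergeometric a b c x) := by
  have hr := ordinaryHypergeometricSeries_radius_eq_one ℝ a b c fun k => by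
    have : (0 : ℝ) ≤ k := k.cast_nonneg
    exact ⟨by linarith, by linarith, by linarith⟩
  have h := (ordinaryHypergeometricSeries ℝ a b c).hasSum (x := x) (by
    rw [hr, Metric.mem_eball, edist_zero_right, Real.enorm_eq_ofReal_abs, ENNReal.ofReal_lt_one]
    exact hx)
  convert! h using 1
  ext j
  rw [ordinaryHypergeometricSeries_apply_eq, smul_eq_mul]
  field_simp

lemma scale_pos {α₂ m₁ m₂ ν : ℝ} (hα₂ : 0 < α₂) (hm₁ : 0 < m₁) (hm₂ : 0 < m₂) (hν : 0 < ν) :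
    0 < scale α₂ m₁ m₂ ν := by
  unfold scale
  positivity

lemma hasSum_seriesTerm {α₁ α₂ m₁ m₂ ν w : ℝ} (hα₂ : 0 < α₂) (hα : α₂ ≤ α₁)
    (hm₁ : 0 < m₁) (hm₂ : 0 < m₂) (hν : 0 < ν) (hw : 0 < w) :
    HasSum (fun j => constA α₁ α₂ m₁ m₂ * constB₀ α₂ m₁ m₂ ν * funB₁ α₂ m₁ m₂ ν w *
        seriesTerm m₁ m₂ ν ((1 - α₂ / α₁) * (w / (scale α₂ m₁ m₂ ν + w))) j)
      (density α₁ α₂ m₁ m₂ ν w) := by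
  have ha := scale_pos hα₂ hm₁ hm₂ hν
  have hα₁ : 0 < α₁ := hα₂.trans_le hα
  rw [density, if_pos hw]
  refine (hasSum_ordinaryHypergeometric (by positivity) (by positivity) (by positivity) ?_).mul_left _
  have h1 : 0 ≤ 1 - α₂ / α₁ := by
    have := (div_le_one hα₁).2 hα
    linarith
  have h2 : 1 - α₂ / α₁ < 1 := by
    have := div_pos hα₂ hα₁
    linarith
  have h3 : w / (scale α₂ m₁ m₂ ν + w) < 1 := (div_lt_one (by positivity)).2 (by linarith)
  rw [abs_of_nonneg (by positivity)]
  exact mul_lt_one_of_nonneg_of_lt_one_left h1 h2 h3.le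

/-- The weight supplies `(m₁/2)_j / j!`; the other two Pochhammer symbols come from the Gamma
functions of the beta prime constant, shifted by `j`. -/
lemma term_eq_mixtureWeight_mul_betaPrimePDFReal {α₁ α₂ m₁ m₂ ν w : ℝ} (hα₂ : 0 < α₂)
    (hα₁ : 0 < α₁) (hm₁ : 0 < m₁) (hm₂ : 0 < m₂) (hν : 0 < ν) (hw : 0 < w) (j : ℕ) :
    constA α₁ α₂ m₁ m₂ * constB₀ α₂ m₁ m₂ ν * funB₁ α₂ m₁ m₂ ν w *
        seriesTerm m₁ m₂ ν ((1 - α₂ / α₁) * (w / (scale α₂ m₁ m₂ ν + w))) j =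
      mixtureWeight (m₁ / 2) (α₂ / α₁) j *
        betaPrimePDFReal (m₁ / 2 + j + m₂ / 2) (ν / 2) (scale α₂ m₁ m₂ ν) w := by
  have ha := scale_pos hα₂ hm₁ hm₂ hν
  have hA : constA α₁ α₂ m₁ m₂ = (α₂ / α₁) ^ (m₁ / 2) := by
    rw [constA, div_self hα₂.ne', Real.one_rpow, mul_one, Real.rpow_neg (by positivity),
      ← Real.inv_rpow (by positivity), inv_div]
  have hM : 0 < (m₁ + m₂) / 2 := by positivity
  have hN : 0 < (ν + m₁ + m₂) / 2 := by positivity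
  have hP := ascPochhammer_pos j _ hM
  have hG := Real.Gamma_pos_of_pos hM
  have hw' : 0 < scale α₂ m₁ m₂ ν + w := by positivity
  rw [hA, constB₀, funB₁, seriesTerm, mixtureWeight, betaPrimePDFReal, if_pos hw,
    show m₁ / 2 + j + m₂ / 2 = (m₁ + m₂) / 2 + j by ring,
    show (m₁ + m₂) / 2 + j + ν / 2 = (ν + m₁ + m₂) / 2 + j by ring,
    show (ν + (m₁ + m₂)) / 2 = (ν + m₁ + m₂) / 2 by ring,
    show (m₁ + m₂) / 2 + j - 1 = (m₁ + m₂ - 2) / 2 + j by ring,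
    Gamma_add_natCast hM, Gamma_add_natCast hN, Real.rpow_add hw, Real.rpow_add hw',
    Real.rpow_natCast, Real.rpow_natCast, mul_pow, div_pow]
  field_simp

lemma density_nonneg {α₁ α₂ m₁ m₂ ν : ℝ} (hα₂ : 0 < α₂) (hα : α₂ ≤ α₁)
    (hm₁ : 0 < m₁) (hm₂ : 0 < m₂) (hν : 0 < ν) (w : ℝ) :
    0 ≤ density α₁ α₂ m₁ m₂ ν w := by
  have hα₁ : 0 < α₁ := hα₂.trans_le hα
  by_cases hw : 0 < w
  · refine (hasSum_seriesTerm hα₂ hα hm₁ hm₂ hν hw).nonneg fun j => ?_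
    rw [term_eq_mixtureWeight_mul_betaPrimePDFReal hα₂ hα₁ hm₁ hm₂ hν hw]
    exact mul_nonneg
      (mixtureWeight_nonneg (by positivity) (by positivity) ((div_le_one hα₁).2 hα) j)
      (betaPrimePDFReal_nonneg (by positivity) (by positivity) (scale_pos hα₂ hm₁ hm₂ hν) w)
  · rw [density, if_neg hw]

lemma ofReal_density_eq_tsum {α₁ α₂ m₁ m₂ ν : ℝ} (hα₂ : 0 < α₂) (hα : α₂ ≤ α₁)
    (hm₁ : 0 < m₁) (hm₂ : 0 < m₂) (hν : 0 < ν) (w : ℝ) :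
    ENNReal.ofReal (density α₁ α₂ m₁ m₂ ν w) =
      ∑' j : ℕ, ENNReal.ofReal (mixtureWeight (m₁ / 2) (α₂ / α₁) j) * ENNReal.ofReal
        (betaPrimePDFReal (m₁ / 2 + j + m₂ / 2) (ν / 2) (scale α₂ m₁ m₂ ν) w) := by
  have hα₁ : 0 < α₁ := hα₂.trans_le hα
  have hc (j : ℕ) : 0 ≤ mixtureWeight (m₁ / 2) (α₂ / α₁) j :=
    mixtureWeight_nonneg (by positivity) (by positivity) ((div_le_one hα₁).2 hα) j
  by_cases hw : 0 < w
  · have h := hasSum_seriesTerm hα₂ hα hm₁ hm₂ hν hw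
    simp_rw [term_eq_mixtureWeight_mul_betaPrimePDFReal hα₂ hα₁ hm₁ hm₂ hν hw] at h
    rw [← h.tsum_eq, ENNReal.ofReal_tsum_of_nonneg _ h.summable]
    · simp_rw [ENNReal.ofReal_mul (hc _)]
    · exact fun j => mul_nonneg (hc j)
        (betaPrimePDFReal_nonneg (by positivity) (by positivity) (scale_pos hα₂ hm₁ hm₂ hν) w)
  · simp [density, betaPrimePDFReal, hw]

/-- The series of measurable terms gives this without any regularity of the hypergeometric function.
-/
lemma measurable_ofReal_density {α₁ α₂ m₁ m₂ ν : ℝ} (hα₂ : 0 < α₂) (hα : α₂ ≤ α₁)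
    (hm₁ : 0 < m₁) (hm₂ : 0 < m₂) (hν : 0 < ν) :
    Measurable fun w => ENNReal.ofReal (density α₁ α₂ m₁ m₂ ν w) := by
  simp_rw [ofReal_density_eq_tsum hα₂ hα hm₁ hm₂ hν]
  exact Measurable.tsum fun j => by fun_prop

/-! ### The law of the ratio -/

lemma lintegral_ratio_eq_lintegral_density {α₁ α₂ m₁ m₂ ν : ℝ} (hα₂ : 0 < α₂) (hα : α₂ ≤ α₁)
    (hm₁ : 0 < m₁) (hm₂ : 0 < m₂) (hν : 0 < ν) {f : ℝ → ℝ≥0∞} (hf : Measurable f) :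
    ∫⁻ x, ∫⁻ y, ∫⁻ v, f (((α₁ * x + α₂ * y) / (m₁ + m₂)) / (v / ν))
        ∂chiSquare ν ∂chiSquare m₂ ∂chiSquare m₁ =
      ∫⁻ w, ENNReal.ofReal (density α₁ α₂ m₁ m₂ ν w) * f w := by
  have hα₁ : 0 < α₁ := hα₂.trans_le hα
  have ha := scale_pos hα₂ hm₁ hm₂ hν
  have hc : 0 < scale α₁ m₁ m₂ ν := scale_pos hα₁ hm₁ hm₂ hν
  have hq : (1 / 2 / scale α₁ m₁ m₂ ν) / (1 / 2 / scale α₂ m₁ m₂ ν) = α₂ / α₁ := by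
    unfold scale
    field_simp
  -- The ordering of the `α`'s makes the first rate the smaller one, as the mixture expansion
  -- requires.
  have hle : 1 / 2 / scale α₁ m₁ m₂ ν ≤ 1 / 2 / scale α₂ m₁ m₂ ν := by
    have : scale α₂ m₁ m₂ ν ≤ scale α₁ m₁ m₂ ν := by
      unfold scale
      gcongr
    gcongr
  set g : ℝ → ℝ≥0∞ := fun t => ∫⁻ v, f (t / v) ∂gammaMeasure (ν / 2) (1 / 2) with hg
  have := isProbabilityMeasure_gammaMeasure (half_pos hν) one_half_pos
  have := isProbabilityMeasure_gammaMeasure (half_pos hm₂) one_half_pos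
  have := isProbabilityMeasure_gammaMeasure (half_pos hm₂)
    (show 0 < 1 / 2 / scale α₂ m₁ m₂ ν by positivity)
  have hgm : Measurable g :=
    Measurable.lintegral_prod_right' (f := fun p : ℝ × ℝ => f (p.1 / p.2)) (by fun_prop)
  have h1 (x y v : ℝ) : ((α₁ * x + α₂ * y) / (m₁ + m₂)) / (v / ν) =
      (scale α₁ m₁ m₂ ν * x + scale α₂ m₁ m₂ ν * y) / v := by
    unfold scale
    field_simp
  have hrate {c : ℝ} (hc : 0 < c) : c * (1 / 2 / c) = 1 / 2 := by field_simp
  have h2 (x : ℝ) : ∫⁻ y, g (x + scale α₂ m₁ m₂ ν * y) ∂gammaMeasure (m₂ / 2) (1 / 2) =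
      ∫⁻ y, g (x + y) ∂gammaMeasure (m₂ / 2) (1 / 2 / scale α₂ m₁ m₂ ν) := by
    rw [← lintegral_comp_mul_gammaMeasure ha (by positivity) (f := fun y => g (x + y))
      (by fun_prop), hrate ha]
  have hGm : Measurable fun x =>
      ∫⁻ y, g (x + y) ∂gammaMeasure (m₂ / 2) (1 / 2 / scale α₂ m₁ m₂ ν) :=
    Measurable.lintegral_prod_right' (f := fun p : ℝ × ℝ => g (p.1 + p.2)) (by fun_prop)
  have h3 : ∫⁻ x, ∫⁻ y, g (scale α₁ m₁ m₂ ν * x + y)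
        ∂gammaMeasure (m₂ / 2) (1 / 2 / scale α₂ m₁ m₂ ν) ∂gammaMeasure (m₁ / 2) (1 / 2) =
      ∫⁻ x, ∫⁻ y, g (x + y) ∂gammaMeasure (m₂ / 2) (1 / 2 / scale α₂ m₁ m₂ ν)
        ∂gammaMeasure (m₁ / 2) (1 / 2 / scale α₁ m₁ m₂ ν) := by
    rw [← lintegral_comp_mul_gammaMeasure hc (by positivity) hGm, hrate hc]
  have h4 (j : ℕ) : ∫⁻ x, ∫⁻ y, g (x + y) ∂gammaMeasure (m₂ / 2) (1 / 2 / scale α₂ m₁ m₂ ν)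
        ∂gammaMeasure (m₁ / 2 + j) (1 / 2 / scale α₂ m₁ m₂ ν) =
      ∫⁻ w, ENNReal.ofReal
        (betaPrimePDFReal (m₁ / 2 + j + m₂ / 2) (ν / 2) (scale α₂ m₁ m₂ ν) w) * f w := by
    rw [lintegral_lintegral_add_gammaMeasure (by positivity) (by positivity) (by positivity) hgm,
      lintegral_lintegral_div_gammaMeasure (by positivity) (by positivity) ha (by positivity) hf]
  have hm (j : ℕ) : Measurable fun w => ENNReal.ofReal
      (betaPrimePDFReal (m₁ / 2 + j + m₂ / 2) (ν / 2) (scale α₂ m₁ m₂ ν) w) * f w := by fun_prop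
  simp_rw [chiSquare, h1]
  change ∫⁻ x, ∫⁻ y, g (scale α₁ m₁ m₂ ν * x + scale α₂ m₁ m₂ ν * y)
    ∂gammaMeasure (m₂ / 2) (1 / 2) ∂gammaMeasure (m₁ / 2) (1 / 2) = _
  simp_rw [h2]
  rw [h3, lintegral_gammaMeasure_eq_tsum (by positivity) (by positivity) hle hGm, hq]
  simp_rw [h4, ← lintegral_const_mul _ (hm _)]
  rw [← lintegral_tsum fun j => by fun_prop]
  simp_rw [ofReal_density_eq_tsum hα₂ hα hm₁ hm₂ hν, ← ENNReal.tsum_mul_right, mul_assoc]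

lemma isProbabilityMeasure_chiSquare {k : ℝ} (hk : 0 < k) :
    IsProbabilityMeasure (chiSquare k) :=
  isProbabilityMeasure_gammaMeasure (half_pos hk) one_half_pos

end GeneralizedF

theorem theorem2 {Ω : Type*} [MeasurableSpace Ω] (P : Measure Ω) [IsProbabilityMeasure P]
    (α₁ α₂ m₁ m₂ ν : ℝ) (hα₂ : 0 < α₂) (hα : α₂ ≤ α₁)
    (hm₁ : 0 < m₁) (hm₂ : 0 < m₂) (hν : 0 < ν)
    (X₁ X₂ V : Ω → ℝ)
    (hX₁ : HasLaw X₁ (GeneralizedF.chiSquare m₁) P)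
    (hX₂ : HasLaw X₂ (GeneralizedF.chiSquare m₂) P)
    (hV : HasLaw V (GeneralizedF.chiSquare ν) P)
    (hX : IndepFun X₁ X₂ P)
    (hXV : IndepFun (fun ω => (X₁ ω, X₂ ω)) V P)
    (W : Ω → ℝ)
    (hW : W = fun ω => ((α₁ * X₁ ω + α₂ * X₂ ω) / (m₁ + m₂)) / (V ω / ν)) :
    HasPDF W P volume ∧
    (∀ w, 0 ≤ GeneralizedF.density α₁ α₂ m₁ m₂ ν w) ∧
    (pdf W P volume =ᵐ[volume]
      fun w => ENNReal.ofReal (GeneralizedF.density α₁ α₂ m₁ m₂ ν w)) ∧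
    (∀ w, 0 < w →
      HasSum
        (fun j => GeneralizedF.constA α₁ α₂ m₁ m₂ * GeneralizedF.constB₀ α₂ m₁ m₂ ν *
          GeneralizedF.funB₁ α₂ m₁ m₂ ν w *
          GeneralizedF.seriesTerm m₁ m₂ ν
            ((1 - α₂ / α₁) * (w / (GeneralizedF.scale α₂ m₁ m₂ ν + w))) j)
        (GeneralizedF.density α₁ α₂ m₁ m₂ ν w)) := by
  have := GeneralizedF.isProbabilityMeasure_chiSquare hm₁
  have := GeneralizedF.isProbabilityMeasure_chiSquare hm₂
  have := GeneralizedF.isProbabilityMeasure_chiSquare hν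
  have hm := GeneralizedF.measurable_ofReal_density hα₂ hα hm₁ hm₂ hν
  have m1 := hX₁.aemeasurable
  have m2 := hX₂.aemeasurable
  have m3 := hV.aemeasurable
  have hWm : AEMeasurable W P := by
    rw [hW]
    fun_prop
  have hlaw : P.map (fun ω => ((X₁ ω, X₂ ω), V ω)) =
      ((GeneralizedF.chiSquare m₁).prod (GeneralizedF.chiSquare m₂)).prod
        (GeneralizedF.chiSquare ν) := by
    rw [(indepFun_iff_map_prod_eq_prod_map_map (m1.prodMk m2) m3).1 hXV,
      (indepFun_iff_map_prod_eq_prod_map_map m1 m2).1 hX, hX₁.map_eq, hX₂.map_eq, hV.map_eq]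
  have hmap : P.map W =
      volume.withDensity fun w => ENNReal.ofReal (GeneralizedF.density α₁ α₂ m₁ m₂ ν w) := by
    -- Independence turns the integral of `f` against the law of `W` into the iterated integral
    -- already computed.
    refine Measure.ext_of_lintegral _ fun f hf => ?_
    rw [lintegral_map' hf.aemeasurable hWm, lintegral_withDensity_eq_lintegral_mul _ hm hf]
    simp only [Pi.mul_apply]
    rw [← GeneralizedF.lintegral_ratio_eq_lintegral_density hα₂ hα hm₁ hm₂ hν hf]
    have hF : Measurable fun p : (ℝ × ℝ) × ℝ =>
        f (((α₁ * p.1.1 + α₂ * p.1.2) / (m₁ + m₂)) / (p.2 / ν)) := by fun_prop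
    have h := lintegral_map' (μ := P) (g := fun ω => ((X₁ ω, X₂ ω), V ω)) hF.aemeasurable
      ((m1.prodMk m2).prodMk m3)
    rw [hlaw, lintegral_prod _ hF.aemeasurable,
      lintegral_prod _ hF.lintegral_prod_right'.aemeasurable] at h
    rw [h, hW]
  have hpdf : HasPDF W P volume := hasPDF_of_map_eq_withDensity hWm _ hm.aemeasurable hmap
  exact ⟨hpdf, GeneralizedF.density_nonneg hα₂ hα hm₁ hm₂ hν,
    (pdf.eq_of_map_eq_withDensity' _ hm.aemeasurable).1 hmap,
    fun w hw => GeneralizedF.hasSum_seriesTerm hα₂ hα hm₁ hm₂ hν hw⟩
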